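/- Let $\Sigma$ be an alphabet, let $n\ge 1$, and let $\Xi=\{x_1,\dots,x_n\}$ be a set of $n$ unknowns. A word equation on $n$ unknowns is a pair of words $u,v\in\Xi^*$, written $u=v$; a solution of it is a monoid morphism $h:\Xi^*\to\Sigma^*$ with $h(u)=h(v)$. The equation is balanced if every unknown $x\in\Xi$ occurs in $u$ and in $v$ the same number of times. The rank of a morphism $h:\Xi^*\to\Sigma^*$ is the smallest number $r$ for which there is a set $A\subseteq\Sigma^*$ of $r$ words such that $h(x)\in A^*$ for every unknown $x\in\Xi$. Let $E_1,E_2$ be word equations on $n$ unknowns for which there is a morphism of rank $n-1$ that is a solution of both $E_1$ and $E_2$. If $E_1$ is not balanced, then every solution of $E_1$ of rank $n-1$ is also a solution of $E_2$. -/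

import Mathlib

/-- A coefficient-free word equation `lhs = rhs` on the `n` unknowns `x₁, …, xₙ`
(indexed by `Fin n`). -/
structure WordEquation (n : ℕ) where
  lhs : FreeMonoid (Fin n)
  rhs : FreeMonoid (Fin n)

/-- The (combinatorial) rank of a morphism `h : Ξ* → Σ*` (here `Ξ = Fin n`, and `σ` is the
alphabet): the smallest `r` for which there is a set `A` of `r` words over `σ` such that
`h x ∈ A*` for every unknown `x`. -/
noncomputable def morphismRank {n : ℕ} {σ : Type*} (h : FreeMonoid (Fin n) →* FreeMonoid σ) : ℕ :=
  sInf {r : ℕ | ∃ A : Finset (FreeMonoid σ), A.card = r ∧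
    ∀ x : Fin n, h (FreeMonoid.of x) ∈ Submonoid.closure (A : Set (FreeMonoid σ))}

/-- The minimum in the definition of the rank is attained. -/
theorem exists_card_eq_morphismRank {n : ℕ} {σ : Type*}
    (h : FreeMonoid (Fin n) →* FreeMonoid σ) :
    ∃ A : Finset (FreeMonoid σ), A.card = morphismRank h ∧
      ∀ x : Fin n, h (FreeMonoid.of x) ∈ Submonoid.closure (A : Set (FreeMonoid σ)) := by
  classical
  refine Nat.sInf_mem (s := {r : ℕ | ∃ A : Finset (FreeMonoid σ), A.card = r ∧
    ∀ x : Fin n, h (FreeMonoid.of x) ∈ Submonoid.closure (A : Set (FreeMonoid σ))}) ?_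
  exact ⟨_, Finset.univ.image fun x => h (FreeMonoid.of x), rfl,
    fun x => Submonoid.subset_closure (by simp)⟩

namespace WordEquation

/-- `h` is a solution of `u = v` if `h u = h v`. -/
def IsSolution {n : ℕ} {σ : Type*} (E : WordEquation n)
    (h : FreeMonoid (Fin n) →* FreeMonoid σ) : Prop :=
  h E.lhs = h E.rhs

/-- The set of solutions of rank `r` of the equation `E`, over the alphabet `σ`. -/
def solOfRank {n : ℕ} (σ : Type*) (E : WordEquation n) (r : ℕ) :
    Set (FreeMonoid (Fin n) →* FreeMonoid σ) :=
  {h | E.IsSolution h ∧ morphismRank h = r}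

/-- `u = v` is balanced if every unknown occurs equally often in `u` and in `v`. -/
def IsBalanced {n : ℕ} (E : WordEquation n) : Prop :=
  ∀ x : Fin n, E.lhs.toList.count x = E.rhs.toList.count x

end WordEquation

/-! Morphisms into `ℤ ≀ ℤ` separate words, so it suffices that every solution `f` of `E₁` in this
group solves `E₂`. This is shown by induction on the total length of the images under a common
solution `h₀`. If `h₀` is nonerasing, `E₁` yields letters with `h₀ j = h₀ i * s`, so `h₀` factors
through `j ↦ i j`; so does `f`, since a group allows division, and unbalancedness is kept. If `h₀`
erases `x₀`, its rank and the defect theorem make both equations trivial once `x₀` is erased. Then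
`E₁` is unbalanced in `x₀`, which forces `f x₀ = 1`, and `f` solves `E₂`. -/

open LaurentPolynomial in
/-- The wreath product `ℤ ≀ ℤ`: the group of affine maps `r ↦ T ^ len * r + val` of `ℤ[T;T⁻¹]`. -/
@[ext]
structure LaurentAffine where
  /-- The exponent of the linear part. -/
  len : ℤ
  /-- The translation part. -/
  val : ℤ[T;T⁻¹]

namespace LaurentAffine

open LaurentPolynomial

noncomputable instance : Mul LaurentAffine :=
  ⟨fun a b => ⟨a.len + b.len, a.val + T a.len * b.val⟩⟩

noncomputable instance : One LaurentAffine := ⟨⟨0, 0⟩⟩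

noncomputable instance : Inv LaurentAffine := ⟨fun a => ⟨-a.len, -(T (-a.len) * a.val)⟩⟩

@[simp] theorem mul_len (a b : LaurentAffine) : (a * b).len = a.len + b.len := rfl

@[simp] theorem mul_val (a b : LaurentAffine) : (a * b).val = a.val + T a.len * b.val := rfl

@[simp] theorem one_len : (1 : LaurentAffine).len = 0 := rfl

@[simp] theorem one_val : (1 : LaurentAffine).val = 0 := rfl

@[simp] theorem inv_len (a : LaurentAffine) : a⁻¹.len = -a.len := rfl

@[simp] theorem inv_val (a : LaurentAffine) : a⁻¹.val = -(T (-a.len) * a.val) := rfl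

noncomputable instance : Group LaurentAffine :=
  Group.ofLeftAxioms
    (fun a b c => by
      ext1
      · simp [add_assoc]
      · simp only [mul_val, mul_len, T_add]; ring)
    (fun a => by ext1 <;> simp)
    (fun a => by ext1 <;> simp)

/-- The augmentation `ℤ[T;T⁻¹] → ℤ`, evaluation at `T = 1`. -/
noncomputable def augmentation : ℤ[T;T⁻¹] →+* ℤ := eval₂ (RingHom.id ℤ) 1

@[simp] theorem augmentation_T (k : ℤ) : augmentation (T k) = 1 := by
  simp [augmentation]

end LaurentAffine

namespace FreeMonoid

variable {α β M : Type*}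

/-! ### Separating words by morphisms into `ℤ ≀ ℤ` -/

section Detect

variable [DecidableEq α]

/-- The morphism to `ℤ ≀ ℤ` that records the positions of the letter `a` in a word. -/
noncomputable def positions (a : α) : FreeMonoid α →* LaurentAffine :=
  lift fun b => ⟨1, if b = a then 1 else 0⟩

@[simp] theorem positions_of (a b : α) : positions a (of b) = ⟨1, if b = a then 1 else 0⟩ := by
  simp [positions]

theorem positions_len (a : α) (w : FreeMonoid α) : (positions a w).len = w.length := by
  induction w using FreeMonoid.inductionOn' with
  | one => simp
  | of_mul b w ih => simp [ih, length_mul]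

theorem exists_polynomial_positions (a : α) (w : FreeMonoid α) :
    ∃ p : Polynomial ℤ, (positions a w).val = p.toLaurent := by
  induction w using FreeMonoid.inductionOn' with
  | one => exact ⟨0, by simp⟩
  | of_mul b w ih =>
    obtain ⟨p, hp⟩ := ih
    refine ⟨(if b = a then 1 else 0) + Polynomial.X * p, ?_⟩
    split_ifs with h <;> simp [hp, h]

/-- The constant coefficient of the translation part reveals the first letter, which is then
cancelled in the group. -/
theorem eq_of_positions_eq {w w' : FreeMonoid α} (h : ∀ a, positions a w = positions a w') :
    w = w' := by
  induction w using FreeMonoid.inductionOn' generalizing w' with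
  | one =>
    cases w' using FreeMonoid.casesOn with
    | one => rfl
    | of_mul c w' =>
      have := congrArg LaurentAffine.len (h c)
      rw [positions_len, positions_len] at this
      simp [length_mul] at this
      omega
  | of_mul b w ih =>
    cases w' using FreeMonoid.casesOn with
    | one =>
      have := congrArg LaurentAffine.len (h b)
      rw [positions_len, positions_len] at this
      simp [length_mul] at this
      omega
    | of_mul c w' =>
      have hbc : b = c := by
        by_contra hne
        obtain ⟨p, hp⟩ := exists_polynomial_positions b w
        obtain ⟨q, hq⟩ := exists_polynomial_positions b w'
        have hv : (positions b (of b * w)).val = (positions b (of c * w')).val := by rw [h b]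
        rw [map_mul, map_mul, LaurentAffine.mul_val, LaurentAffine.mul_val, hp, hq] at hv
        simp only [positions_of, if_true, if_neg (Ne.symm hne)] at hv
        rw [← Polynomial.toLaurent_X, ← map_mul, ← map_mul, ← map_one Polynomial.toLaurent,
          ← map_zero Polynomial.toLaurent, ← map_add, ← map_add, Polynomial.toLaurent_inj] at hv
        simpa using congrArg (fun r => Polynomial.coeff r 0) hv
      subst hbc
      rw [ih fun a => mul_left_cancel ((map_mul _ _ _).symm.trans ((h a).trans (map_mul _ _ _)))]

theorem eq_of_forall_laurentAffine {u v : FreeMonoid α}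
    (h : ∀ f : FreeMonoid α →* LaurentAffine, f u = f v) : u = v :=
  eq_of_positions_eq fun a => h (positions a)

end Detect

/-! ### Erasing an unknown -/

section Erase

variable [DecidableEq α]

/-- The morphism that erases the letter `x₀`. -/
def erase (x₀ : α) : FreeMonoid α →* FreeMonoid {x // x ≠ x₀} :=
  lift fun x => if hx : x ≠ x₀ then of ⟨x, hx⟩ else 1

@[simp] theorem erase_of_self (x₀ : α) : erase x₀ (of x₀) = 1 := by
  simp [erase]

@[simp] theorem erase_of_ne {x₀ x : α} (hx : x ≠ x₀) : erase x₀ (of x) = of ⟨x, hx⟩ := by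
  simp [erase, hx]

theorem comp_erase [Monoid M] {x₀ : α} {f : FreeMonoid α →* M} (hf : f (of x₀) = 1) :
    (f.comp (map Subtype.val)).comp (erase x₀) = f := by
  refine hom_eq fun x => ?_
  by_cases hx : x = x₀
  · subst hx; simp [hf]
  · simp [hx]

theorem count_erase (x₀ : α) (x : {x // x ≠ x₀}) (u : FreeMonoid α) :
    (erase x₀ u).toList.count x = u.toList.count x.1 := by
  induction u using FreeMonoid.inductionOn' with
  | one => simp
  | of_mul y u ih =>
    by_cases hy : y = x₀
    · subst hy; simp [ih, x.2.symm]
    · simp [ih, List.count_cons, hy]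

theorem len_erase (x₀ : α) (f : FreeMonoid α →* LaurentAffine) (u : FreeMonoid α) :
    (f u).len = u.toList.count x₀ * (f (of x₀)).len +
      (f (map Subtype.val (erase x₀ u))).len := by
  induction u using FreeMonoid.inductionOn' with
  | one => simp
  | of_mul y u ih =>
    by_cases hy : y = x₀
    · subst hy; simp [ih]; ring
    · simp [ih, hy]; ring

/-- Each `x₀` contributes its value times a power of `T` and shifts nothing after it; `d` is the sum
of these powers, so setting `T = 1` counts them. -/
theorem exists_val_erase {x₀ : α} {f : FreeMonoid α →* LaurentAffine}
    (hf : (f (of x₀)).len = 0) (u : FreeMonoid α) :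
    ∃ d, LaurentAffine.augmentation d = u.toList.count x₀ ∧
      (f u).val = d * (f (of x₀)).val + (f (map Subtype.val (erase x₀ u))).val := by
  induction u using FreeMonoid.inductionOn' with
  | one => exact ⟨0, by simp⟩
  | of_mul y u ih =>
    obtain ⟨d, hd, hu⟩ := ih
    by_cases hy : y = x₀
    · subst hy
      refine ⟨1 + d, by simp [hd, add_comm], ?_⟩
      simp [hu, hf]; ring
    · refine ⟨LaurentPolynomial.T (f (of y)).len * d,
        by simp [hd, hy], ?_⟩
      simp [hu, hy]; ring

/-- An equation that becomes trivial when `x₀` is erased, but that is not balanced in `x₀`, forces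
`x₀` to be trivial in `ℤ ≀ ℤ`. -/
theorem map_of_eq_one_of_erase_eq {x₀ : α} {f : FreeMonoid α →* LaurentAffine}
    {u v : FreeMonoid α} (he : erase x₀ u = erase x₀ v)
    (hc : u.toList.count x₀ ≠ v.toList.count x₀) (hf : f u = f v) : f (of x₀) = 1 := by
  have hlen : (f (of x₀)).len = 0 := by
    have h := congrArg LaurentAffine.len hf
    rw [len_erase x₀ f u, len_erase x₀ f v, he, add_left_inj] at h
    by_contra h0
    exact hc (by exact_mod_cast mul_right_cancel₀ h0 h)
  refine LaurentAffine.ext hlen ?_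
  obtain ⟨d, hd, hu⟩ := exists_val_erase hlen u
  obtain ⟨e, hde, hv⟩ := exists_val_erase hlen v
  have h := congrArg LaurentAffine.val hf
  rw [hu, hv, he, add_left_inj] at h
  -- `ℤ[T;T⁻¹]` is a domain, so a nonzero value would force `d = e`, hence equal counts.
  by_contra h0
  have hde' := mul_right_cancel₀ h0 h
  exact hc (by rw [hde', hde] at hd; exact_mod_cast hd.symm)

end Erase

/-! ### Elementary substitutions -/

section Step

variable [DecidableEq α]

/-- The elementary morphism that maps `j` to `i j` and fixes the other letters. -/
def elementary (i j : α) : FreeMonoid α →* FreeMonoid α :=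
  lift (Function.update of j (of i * of j))

/-- The morphism that agrees with `f` except that it maps `j` to `s`. -/
def updateLetter [Monoid M] (f : FreeMonoid α →* M) (j : α) (s : M) : FreeMonoid α →* M :=
  lift (Function.update (fun x => f (of x)) j s)

@[simp] theorem updateLetter_self [Monoid M] (f : FreeMonoid α →* M) (j : α) (s : M) :
    updateLetter f j s (of j) = s := by
  simp [updateLetter]

@[simp] theorem updateLetter_of_ne [Monoid M] (f : FreeMonoid α →* M) {j x : α} (s : M)
    (hx : x ≠ j) : updateLetter f j s (of x) = f (of x) := by
  simp [updateLetter, hx]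

@[simp] theorem elementary_self (i j : α) : elementary i j (of j) = of i * of j := by
  simp [elementary]

@[simp] theorem elementary_of_ne (i : α) {j x : α} (hx : x ≠ j) :
    elementary i j (of x) = of x := by
  simp [elementary, hx]

theorem updateLetter_comp_elementary [Monoid M] {f : FreeMonoid α →* M} {i j : α} (hij : i ≠ j)
    {s : M} (hs : f (of j) = f (of i) * s) :
    (updateLetter f j s).comp (elementary i j) = f := by
  refine hom_eq fun x => ?_
  by_cases hx : x = j
  · subst hx; simp [hij, hs]
  · simp [hx]

theorem updateLetter_elementary [Monoid M] {f : FreeMonoid α →* M} {i j : α} (hij : i ≠ j)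
    {s : M} (hs : f (of j) = f (of i) * s) (u : FreeMonoid α) :
    updateLetter f j s (elementary i j u) = f u :=
  DFunLike.congr_fun (updateLetter_comp_elementary hij hs) u

theorem count_elementary {i j : α} (hij : i ≠ j) (x : α) (u : FreeMonoid α) :
    (elementary i j u).toList.count x =
      u.toList.count x + if x = i then u.toList.count j else 0 := by
  induction u using FreeMonoid.inductionOn' with
  | one => simp
  | of_mul y u ih =>
    by_cases hy : y = j
    · subst hy
      by_cases hx : x = i
      · subst hx
        simp [ih, mul_assoc, hij.symm]; ring
      · simp [ih, List.count_cons, mul_assoc, hx, Ne.symm hx]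
    · by_cases hx : x = i
      · subst hx; simp [ih, List.count_cons, hy]; ring
      · simp [ih, List.count_cons, hy, hx]

/-- On letter counts, `elementary i j` acts by an invertible transvection. -/
theorem count_eq_of_count_elementary_eq {i j : α} (hij : i ≠ j) {u v : FreeMonoid α}
    (h : ∀ x, (elementary i j u).toList.count x = (elementary i j v).toList.count x) (x : α) :
    u.toList.count x = v.toList.count x := by
  have hj : u.toList.count j = v.toList.count j := by
    simpa [count_elementary hij, hij.symm] using h j
  simpa [count_elementary hij, hj] using h x

/-- Every morphism into a group factors through `elementary i j`, and those into `ℤ ≀ ℤ` separate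
words. -/
theorem elementary_injective {i j : α} (hij : i ≠ j) :
    Function.Injective (elementary i j) := fun u v huv =>
  eq_of_forall_laurentAffine fun f => by
    have hs : f (of j) = f (of i) * ((f (of i))⁻¹ * f (of j)) := by group
    rw [← updateLetter_elementary hij hs u, huv, updateLetter_elementary hij hs v]

/-- Two distinct words with the same image under a nonerasing morphism produce two letters such that
the image of one is a prefix of the image of the other. -/
theorem exists_prefix_of_map_eq {h : FreeMonoid α →* FreeMonoid β} (h1 : ∀ x, h (of x) ≠ 1)
    {u v : FreeMonoid α} (huv : u ≠ v) (heq : h u = h v) :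
    ∃ i j, i ≠ j ∧ ∃ s, h (of j) = h (of i) * s := by
  induction u using FreeMonoid.inductionOn' generalizing v with
  | one =>
    cases v using FreeMonoid.casesOn with
    | one => exact absurd rfl huv
    | of_mul y v =>
      rw [map_one, map_mul] at heq
      exact absurd (List.append_eq_nil_iff.1 heq.symm).1 (h1 y)
  | of_mul x u ih =>
    cases v using FreeMonoid.casesOn with
    | one =>
      rw [map_one, map_mul] at heq
      exact absurd (List.append_eq_nil_iff.1 heq).1 (h1 x)
    | of_mul y v =>
      rw [map_mul, map_mul] at heq
      by_cases hxy : x = y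
      · subst hxy
        exact ih (fun e => huv (by rw [e])) (mul_left_cancel heq)
      · rcases List.append_eq_append_iff.1 heq with ⟨s, hs, -⟩ | ⟨s, hs, -⟩
        · exact ⟨x, y, hxy, s, hs⟩
        · exact ⟨y, x, Ne.symm hxy, s, hs⟩

end Step

/-! ### The defect theorem and the induction on a common solution -/

section Defect

variable [DecidableEq α]

theorem sum_length_updateLetter_lt [Fintype α] {h : FreeMonoid α →* FreeMonoid β} {i j : α} {s : FreeMonoid β}
    (hi : h (of i) ≠ 1) (hs : h (of j) = h (of i) * s) :
    ∑ x, (updateLetter h j s (of x)).length < ∑ x, (h (of x)).length := by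
  have hlt : s.length < (h (of j)).length := by
    rw [hs, length_mul]
    have := mt length_eq_zero.1 hi
    omega
  refine Finset.sum_lt_sum (fun x _ => ?_) ⟨j, Finset.mem_univ j, by simpa using hlt⟩
  by_cases hx : x = j
  · subst hx; simpa using hlt.le
  · simp [hx]

theorem map_of_mem_closure_of_updateLetter {h : FreeMonoid α →* FreeMonoid β} {i j : α}
    (hij : i ≠ j) {s : FreeMonoid β} (hs : h (of j) = h (of i) * s) {S : Submonoid (FreeMonoid β)}
    (hS : ∀ x, updateLetter h j s (of x) ∈ S) (x : α) : h (of x) ∈ S := by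
  by_cases hx : x = j
  · subst hx
    rw [hs]
    exact S.mul_mem (by simpa [hij] using hS i) (by simpa using hS x)
  · simpa [hx] using hS x

/-- The defect theorem: words that satisfy a nontrivial relation are products of fewer words. -/
theorem exists_card_lt_of_map_eq [Fintype α] (h : FreeMonoid α →* FreeMonoid β) {u v : FreeMonoid α}
    (huv : u ≠ v) (heq : h u = h v) :
    ∃ A : Finset (FreeMonoid β), A.card < Fintype.card α ∧
      ∀ x, h (of x) ∈ Submonoid.closure (A : Set (FreeMonoid β)) := by
  classical
  induction hN : ∑ x, (h (of x)).length using Nat.strong_induction_on generalizing h u v with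
  | _ N ih =>
  subst hN
  by_cases h1 : ∃ x₀, h (of x₀) = 1
  · obtain ⟨x₀, hx₀⟩ := h1
    refine ⟨(Finset.univ.erase x₀).image fun x => h (of x), ?_, fun x => ?_⟩
    · refine Finset.card_image_le.trans_lt ?_
      exact Finset.card_lt_card (Finset.erase_ssubset (Finset.mem_univ x₀))
    · by_cases hx : x = x₀
      · rw [hx, hx₀]; exact Submonoid.one_mem _
      · exact Submonoid.subset_closure (Finset.mem_coe.2 (Finset.mem_image.2 ⟨x, by simp [hx], rfl⟩))
  · push Not at h1
    obtain ⟨i, j, hij, s, hs⟩ := exists_prefix_of_map_eq h1 huv heq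
    obtain ⟨A, hA, hmem⟩ := ih _ (sum_length_updateLetter_lt (h1 i) hs) (updateLetter h j s)
      ((elementary_injective hij).ne huv)
      (by rw [updateLetter_elementary hij hs, updateLetter_elementary hij hs, heq]) rfl
    exact ⟨A, hA, map_of_mem_closure_of_updateLetter hij hs hmem⟩

theorem map_eq_map_of_common_solution [Fintype α] (h : FreeMonoid α →* FreeMonoid β)
    (hrank : ∀ A : Finset (FreeMonoid β),
      (∀ x, h (of x) ∈ Submonoid.closure (A : Set (FreeMonoid β))) → Fintype.card α ≤ A.card + 1)
    {u v u' v' : FreeMonoid α} (hbal : ¬ ∀ x, u.toList.count x = v.toList.count x)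
    (huv : h u = h v) (huv' : h u' = h v') {f : FreeMonoid α →* LaurentAffine} (hf : f u = f v) :
    f u' = f v' := by
  induction hN : ∑ x, (h (of x)).length using Nat.strong_induction_on
    generalizing h u v u' v' f with
  | _ N ih =>
  subst hN
  by_cases h1 : ∃ x₀, h (of x₀) = 1
  · obtain ⟨x₀, hx₀⟩ := h1
    -- Otherwise the defect theorem on the remaining letters gives a set of at most `Fintype.card α
    -- - 2` words, contradicting `hrank`.
    have herase {w w' : FreeMonoid α} (hw : h w = h w') : erase x₀ w = erase x₀ w' := by
      by_contra hne
      rw [← comp_erase hx₀] at hw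
      obtain ⟨A, hA, hmem⟩ := exists_card_lt_of_map_eq (h.comp (map Subtype.val)) hne hw
      have hle := hrank A fun x => by
        by_cases hx : x = x₀
        · rw [hx, hx₀]; exact Submonoid.one_mem _
        · simpa using hmem ⟨x, hx⟩
      rw [Fintype.card_subtype_compl, Fintype.card_subtype_eq] at hA
      omega
    have hc : u.toList.count x₀ ≠ v.toList.count x₀ := fun hc => hbal fun x => by
      by_cases hx : x = x₀
      · rw [hx, hc]
      · rw [← count_erase x₀ ⟨x, hx⟩, herase huv, count_erase]
    rw [← comp_erase (map_of_eq_one_of_erase_eq (herase huv) hc hf)]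
    simp only [MonoidHom.comp_apply, herase huv']
  · push Not at h1
    obtain ⟨i, j, hij, s, hs⟩ :=
      exists_prefix_of_map_eq h1 (fun e => hbal fun x => by rw [e]) huv
    -- Inverses let `f` follow the factorization of `h`, although `f` need not have any prefix
    -- relation of its own.
    have hfs : f (of j) = f (of i) * ((f (of i))⁻¹ * f (of j)) := by group
    have key := @ih _ (sum_length_updateLetter_lt (h1 i) hs) (updateLetter h j s)
      (fun A hA => hrank A (map_of_mem_closure_of_updateLetter hij hs hA))
      (elementary i j u) (elementary i j v) (elementary i j u') (elementary i j v')
      (fun hb => hbal (count_eq_of_count_elementary_eq hij hb))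
      (by simpa only [updateLetter_elementary hij hs] using huv)
      (by simpa only [updateLetter_elementary hij hs] using huv')
      (updateLetter f j ((f (of i))⁻¹ * f (of j)))
      (by simpa only [updateLetter_elementary hij hfs] using hf) rfl
    simpa only [updateLetter_elementary hij hfs] using key

end Defect

end FreeMonoid

theorem mainTheorem4 {σ : Type*} {n : ℕ} (hn : 1 ≤ n) (E₁ E₂ : WordEquation n)
    (hpair : (E₁.solOfRank σ (n - 1) ∩ E₂.solOfRank σ (n - 1)).Nonempty)
    (hE₁ : ¬ E₁.IsBalanced) :
    E₁.solOfRank σ (n - 1) ⊆ E₂.solOfRank σ (n - 1) := by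
  classical
  obtain ⟨h₀, ⟨h₁, hr⟩, h₂, -⟩ := hpair
  rintro h ⟨hsol, hrank⟩
  -- The word solution `h` is tested through the group-valued solutions `f.comp h` of `E₁`.
  refine ⟨FreeMonoid.eq_of_forall_laurentAffine fun f => ?_, hrank⟩
  refine FreeMonoid.map_eq_map_of_common_solution h₀ (fun A hA => ?_) hE₁ h₁ h₂
    (f := f.comp h) (congrArg f hsol)
  have hle : morphismRank h₀ ≤ A.card := Nat.sInf_le ⟨A, rfl, hA⟩
  rw [Fintype.card_fin]
  omega
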